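/- Theorem 1.2. Let $\mathbb U=\{z\in\mathbb C:\operatorname{Im} z>0\}$ be the upper half-plane with the hyperbolic metric $|dz|/\operatorname{Im} z$, and let $\gamma=\{it:t>0\}$. Let $\Phi=\varphi(z)\,dz^2$ be a holomorphic quadratic differential on $\mathbb U$, with pointwise norm $\|\Phi(z)\|=|\varphi(z)|(\operatorname{Im} z)^2$. Let $0<r<\tfrac12$ and let $K$ be a real number with $K/r<\tfrac14$ such that $\|\Phi(z)\|\le K$ for every $z\in\mathbb U$ at hyperbolic distance less than $r$ from $\gamma$. Then there is a locally univalent (holomorphic and locally injective) map $f:\mathbb U\to\widehat{\mathbb C}=\mathbb C\cup\{\infty\}$ such that - the Schwarzian derivative $Sf=\Big(\frac{f'''}{f'}-\frac32\big(\frac{f''}{f'}\big)^2\Big)dz^2$ equals $\Phi$ on $\mathbb U$ (at poles of $f$, $Sf$ is computed from $1/f$); - $f(it)\to 0$ as $t\to 0^+$, $f(it)\to\infty$ as $t\to\infty$, and $f(it)\in\mathbb C^*=\mathbb C\setminus\{0\}$ for all $t>0$; - with $\mathbf n=z\frac{\partial}{\partial z}$, $$\|f^*\mathbf n-\mathbf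 n\|_\gamma\le\frac{9K}{r}\qquad\text{and}\qquad\|f_*\mathbf n-\mathbf n\|_{f\circ\gamma}\le\frac{9K}{r}.$$ Here $(f^*\mathbf n)(z)=(df_z)^{-1}\mathbf n(f(z))$, and $\|\cdot\|_\gamma$ is the supremum over $\gamma$ of the hyperbolic length; $f_*\mathbf n-\mathbf n$ is the field $df_z(\mathbf n(z))-\mathbf n(f(z))$, $z\in\gamma$, along the curve $f\circ\gamma$ in $\mathbb C^*$, and $\|\cdot\|_{f\circ\gamma}$ is the supremum over $z\in\gamma$ of its length in the Euclidean (flat cylinder) metric $|dw|/|w|$ of $\mathbb C^*\cong\mathbb C/2\pi i\mathbb Z$. In other words, for all $z\in\gamma$, $$\left|\frac{f(z)}{z f'(z)}-1\right|\le\frac{9K}r\qquad\text{and}\qquad\left|\frac{z f'(z)}{f(z)}-1\right|\le\frac{9K}r.$$ -/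

import Mathlib

open Filter Topology UpperHalfPlane
open scoped Manifold OnePoint

noncomputable section

/-!
The Riemann sphere is `OnePoint ℂ`, with the affine coordinate `w` on `ℂ` and the coordinate `1 / w`
on the complement of `0`. At a finite point the *preferred* coordinate is `w`, at `∞` it is `1 / w`.
A tangent vector to the sphere at `p` is given by its coefficient in the preferred coordinate at `p`;
a tangent vector to the upper half-plane is given by its coefficient of `∂/∂z`.
-/

namespace HypSchwarzian

/-- The affine coordinate `w` (the value at `∞` is irrelevant). -/
def affineCoord (q : OnePoint ℂ) : ℂ := q.elim 0 id

/-- The coordinate `1 / w` near `∞` (the value at the point `0` is irrelevant). -/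
def coordAtInfty (q : OnePoint ℂ) : ℂ := q.elim 0 (fun w => w⁻¹)

/-- The preferred coordinate at the point `p` of the sphere, as a function of `q` near `p`. -/
def sphereCoord (p : OnePoint ℂ) : OnePoint ℂ → ℂ :=
  p.elim coordAtInfty (fun _ => affineCoord)

/-- The expression of `f : ℍ → OnePoint ℂ` near `z`, in the coordinate of the half-plane and in the
preferred coordinate at `f z`. -/
def localRep (f : ℍ → OnePoint ℂ) (z : ℍ) : ℂ → ℂ :=
  fun ζ => sphereCoord (f z) (f (ofComplex ζ))

/-- Holomorphic maps from the upper half-plane to the Riemann sphere. -/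
def HolomorphicToSphere (f : ℍ → OnePoint ℂ) : Prop :=
  Continuous f ∧ ∀ z : ℍ, DifferentiableAt ℂ (localRep f z) z

/-- Locally univalent maps: holomorphic and locally injective. -/
def LocallyUnivalent (f : ℍ → OnePoint ℂ) : Prop :=
  HolomorphicToSphere f ∧ ∀ z : ℍ, ∃ U ∈ 𝓝 z, Set.InjOn f U

/-- The Schwarzian `g''' / g' - (3 / 2) (g'' / g')²` of a holomorphic function. -/
def schwarzian (g : ℂ → ℂ) (ζ : ℂ) : ℂ :=
  iteratedDeriv 3 g ζ / deriv g ζ - 3 / 2 * (iteratedDeriv 2 g ζ / deriv g ζ) ^ 2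

/-- The coefficient of `dz²` in the Schwarzian derivative `Sf`. As `S(1 / g) = S(g)`, the choice of
the coordinate on the sphere does not matter. -/
def schwarzianOnH (f : ℍ → OnePoint ℂ) (z : ℍ) : ℂ := schwarzian (localRep f z) z

/-- A holomorphic quadratic differential `φ(z) dz²` on the upper half-plane. -/
def IsHolomorphicQuadraticDifferential (φ : ℍ → ℂ) : Prop := MDiff φ

/-- The pointwise hyperbolic norm of `φ(z) dz²`: the ratio of the area form `|φ| dx dy` and the
hyperbolic area form `dx dy / y²`. -/
def qdNorm (φ : ℍ → ℂ) (z : ℍ) : ℝ := ‖φ z‖ * z.im ^ 2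

/-- The imaginary axis in the upper half-plane, a geodesic. -/
def imagAxis : Set ℍ := {z | z.re = 0}

/-- The point `i t` (meaningful for `0 < t`). -/
def axisPoint (t : ℝ) : ℍ := ofComplex (t * Complex.I)

/-- The field `n = w ∂/∂w` on the sphere, in preferred coordinates. In the coordinate `u = 1 / w` it
is `-u ∂/∂u`, so it vanishes at `∞`. -/
def nSphere (p : OnePoint ℂ) : ℂ := p.elim 0 id

/-- The field `n = z ∂/∂z` on the upper half-plane. -/
def nHalfPlane (z : ℍ) : ℂ := z

/-- The pull-back `(f^*V)(z) = (df_z)⁻¹ V(f z)` of a field `V` on the sphere. -/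
def pullback (f : ℍ → OnePoint ℂ) (V : OnePoint ℂ → ℂ) (z : ℍ) : ℂ :=
  V (f z) / deriv (localRep f z) z

/-- The push-forward `df_z (X z)`, a tangent vector at `f z`, of a field `X` on the half-plane. -/
def pushforward (f : ℍ → OnePoint ℂ) (X : ℍ → ℂ) (z : ℍ) : ℂ :=
  deriv (localRep f z) z * X z

/-- The hyperbolic length of the tangent vector `v ∂/∂z` at `z`. -/
def hypLength (z : ℍ) (v : ℂ) : ℝ := ‖v‖ / z.im

/-- The length of the tangent vector `v ∂/∂w` at `p ∈ ℂ \ {0}` in the complete Euclidean (flat)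
metric `|dw| / |w|` of the cylinder `ℂ \ {0} ≅ ℂ / 2πiℤ`. -/
def cylLength (p : OnePoint ℂ) (v : ℂ) : ℝ := ‖v‖ / ‖affineCoord p‖

end HypSchwarzian

end

/-! Write `φ = -2 Q`. A quotient `f = u / v` of independent solutions of the linear equation `u'' =
Q u` has Schwarzian `φ`, and it is locally univalent because its Wronskian `W` is a nonzero constant
(`SolvesLinearODE.projectiveMap_spec`). It remains to choose `u` and `v`.

For `Q = 0` the right choice is `u = z`, `v = 1`. In general, put `z = i e^x` and `z u' / u = 1 / 2
+ a(x)`. Then `a' = 1 / 4 + z² Q - a²`, a small perturbation of an equation with equilibria `1 / 2`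
and `-1 / 2`, since `|z² Q| ≤ K / 2` on the axis. A contraction argument (`exists_bounded_riccati`)
gives solutions `a`, `b` on all of `ℝ` within `K` of `1 / 2` and `-1 / 2`. Let `u`, `v` be the
solutions with these logarithmic derivatives (`exists_solutions_small_riccati`).

On the axis `z f' / f = a - b`, which is within `2 K` of `1`; its inverse is within `4 K` of `1`,
and both bounds lie below `9 K / r`. Finally `log |f|` is the integral of `Re (a - b) ≥ 1 / 2`,
which gives the limits `0` and `∞`. -/

noncomputable section

namespace HypSchwarzian

/-! ### Power series and the linear equation on the unit disc. -/

/-- The coefficients are `O(ρ⁻ⁿ)` for every `ρ < 1`: the power series converges on the unit disc. -/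
def ConvergesOnDisc (c : ℕ → ℂ) : Prop :=
  ∀ ρ : ℝ, 0 < ρ → ρ < 1 → ∃ C : ℝ, ∀ n, ‖c n‖ * ρ ^ n ≤ C

theorem ConvergesOnDisc.summable {c : ℕ → ℂ} (hc : ConvergesOnDisc c) {ρ : ℝ} (h0 : 0 ≤ ρ)
    (h1 : ρ < 1) : Summable fun n => ‖c n‖ * ρ ^ n := by
  obtain ⟨σ, h2, h3⟩ := exists_between h1
  have hσ : 0 < σ := h0.trans_lt h2
  obtain ⟨C, hC⟩ := hc σ hσ h3
  have hg : Summable fun n => C * (ρ / σ) ^ n :=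
    (summable_geometric_of_lt_one (by positivity) ((div_lt_one hσ).2 h2)).mul_left C
  refine Summable.of_nonneg_of_le (fun n => by positivity) (fun n => ?_) hg
  calc ‖c n‖ * ρ ^ n = (‖c n‖ * σ ^ n) * (ρ / σ) ^ n := by
        rw [div_pow]; field_simp
    _ ≤ C * (ρ / σ) ^ n := by gcongr; exact hC n

theorem ConvergesOnDisc.summable_norm {c : ℕ → ℂ} (hc : ConvergesOnDisc c) {w : ℂ}
    (hw : w ∈ Metric.ball (0 : ℂ) 1) : Summable fun n => ‖c n * w ^ n‖ := by
  simpa only [norm_mul, norm_pow] using hc.summable (norm_nonneg w) (mem_ball_zero_iff.1 hw)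

/-- Passing from `ρ` to a larger radius `σ < 1` gains a factor `(ρ / σ) ^ n`, which absorbs the
factor `n`. -/
theorem ConvergesOnDisc.derivative {c : ℕ → ℂ} (hc : ConvergesOnDisc c) :
    ConvergesOnDisc fun n => (n + 1) * c (n + 1) := by
  intro ρ h0 h1
  obtain ⟨σ, h2, h3⟩ := exists_between h1
  have hσ : 0 < σ := h0.trans h2
  obtain ⟨C, hC⟩ := hc σ hσ h3
  have hq : ρ / σ < 1 := (div_lt_one hσ).2 h2
  have ht : Tendsto (fun n : ℕ => (n : ℝ) * (ρ / σ) ^ n) atTop (𝓝 0) :=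
    tendsto_self_mul_const_pow_of_lt_one (by positivity) hq
  obtain ⟨B, hB⟩ := ht.bddAbove_range
  refine ⟨C / ρ * B, fun n => ?_⟩
  have h4 := hB ⟨n + 1, rfl⟩
  have hC0 : 0 ≤ C := le_trans (by positivity) (hC 0)
  have h5 : ‖((n : ℂ) + 1) * c (n + 1)‖ = (n + 1 : ℝ) * ‖c (n + 1)‖ := by
    rw [norm_mul]; congr 1
    exact_mod_cast Complex.norm_natCast (n + 1)
  have h6 : (n + 1 : ℝ) * ‖c (n + 1)‖ * ρ ^ n =
      (‖c (n + 1)‖ * σ ^ (n + 1)) / ρ * (((n + 1 : ℕ) : ℝ) * (ρ / σ) ^ (n + 1)) := by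
    rw [div_pow]; push_cast; field_simp; ring
  rw [h5, h6]
  have := hC (n + 1)
  gcongr

theorem ConvergesOnDisc.hasDerivAt {c : ℕ → ℂ} (hc : ConvergesOnDisc c) {w : ℂ}
    (hw : w ∈ Metric.ball (0 : ℂ) 1) :
    HasDerivAt (fun w => ∑' n, c n * w ^ n) (∑' n : ℕ, ((n + 1) * c (n + 1)) * w ^ n) w := by
  obtain ⟨ρ, h1, h2⟩ := exists_between (mem_ball_zero_iff.1 hw)
  have hρ : 0 ≤ ρ := (norm_nonneg w).trans h1.le
  have hs := hc.derivative.summable hρ h2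
  -- The truncated exponent `n - 1` is harmless: the term `n = 0` carries the factor `0`.
  have hs' : Summable fun n : ℕ => ‖(n : ℂ) * c n‖ * ρ ^ (n - 1) := by
    rw [← summable_nat_add_iff 1]; simpa using hs
  have key := hasDerivAt_tsum_of_isPreconnected (y₀ := 0) hs' (Metric.isOpen_ball (x := (0 : ℂ)))
    (convex_ball (0 : ℂ) ρ).isPreconnected (g := fun n w => c n * w ^ n)
    (g' := fun n w => (n : ℂ) * c n * w ^ (n - 1)) (fun n y _ => ?_) (fun n y hy => ?_)
    (Metric.mem_ball_self ((norm_nonneg w).trans_lt h1)) ?_ (mem_ball_zero_iff.2 h1)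
  · have hsum : Summable fun n : ℕ => (n : ℂ) * c n * w ^ (n - 1) := by
      refine Summable.of_norm_bounded hs' fun n => ?_
      rw [norm_mul, norm_pow]; gcongr
    rw [hsum.tsum_eq_zero_add] at key
    simpa using key
  · have h := (hasDerivAt_pow n y).const_mul (c n)
    rwa [← mul_assoc, mul_comm (c n)] at h
  · rw [norm_mul, norm_pow]
    have := (mem_ball_zero_iff.1 hy).le
    gcongr
  · exact (hc.summable_norm (Metric.mem_ball_self one_pos)).of_norm

/-- The coefficients of the power series solution of `v'' = q v`, where `q = ∑ aₙ wⁿ`, with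
`v(0) = A` and `v'(0) = B`. -/
def odeCoeff (a : ℕ → ℂ) (A B : ℂ) : ℕ → ℂ
  | 0 => A
  | 1 => B
  | n + 2 => (∑ k : Fin (n + 1), odeCoeff a A B k * a (n - k)) / ((n + 2) * (n + 1))
termination_by n => n
decreasing_by have := k.2; omega

theorem odeCoeff_add_two (a : ℕ → ℂ) (A B : ℂ) (n : ℕ) :
    odeCoeff a A B (n + 2) =
      (∑ k ∈ Finset.range (n + 1), odeCoeff a A B k * a (n - k)) / ((n + 2) * (n + 1)) := by
  rw [odeCoeff, Finset.sum_range]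

/-- If `|aₙ| ρⁿ ≤ M` and the earlier terms `d k` are at most `C`, the recursion gives `d (m + 2) ≤ C
M / (m + 2)`. This is at most `C` once `m ≥ M`, so `C` only has to dominate finitely many terms. -/
theorem convergesOnDisc_odeCoeff {a : ℕ → ℂ} (ha : ConvergesOnDisc a) (A B : ℂ) :
    ConvergesOnDisc (odeCoeff a A B) := by
  intro ρ h0 h1
  obtain ⟨M, hM⟩ := ha ρ h0 h1
  have hM0 : 0 ≤ M := le_trans (by positivity) (hM 0)
  set d : ℕ → ℝ := fun n => ‖odeCoeff a A B n‖ * ρ ^ n with hd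
  have hd0 : ∀ n, 0 ≤ d n := fun n => by positivity
  obtain ⟨N, hN⟩ := exists_nat_ge M
  set C := ∑ k ∈ Finset.range (N + 2), d k with hC
  have hC0 : 0 ≤ C := Finset.sum_nonneg fun k _ => hd0 k
  refine ⟨C, fun n => ?_⟩
  change d n ≤ C
  induction n using Nat.strong_induction_on with
  | _ n ih =>
    rcases lt_or_ge n (N + 2) with hn | hn
    · exact Finset.single_le_sum (fun k _ => hd0 k) (Finset.mem_range.2 hn)
    · obtain ⟨m, rfl⟩ : ∃ m, n = m + 2 := ⟨n - 2, by omega⟩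
      have hmN : M ≤ m := hN.trans (by exact_mod_cast (by omega : N ≤ m))
      have h3 : ‖((m : ℂ) + 2) * (m + 1)‖ = ((m : ℝ) + 2) * (m + 1) := by
        rw [norm_mul]; congr 1
        · exact_mod_cast Complex.norm_natCast (m + 2)
        · exact_mod_cast Complex.norm_natCast (m + 1)
      have h4 : ‖∑ k ∈ Finset.range (m + 1), odeCoeff a A B k * a (m - k)‖ * ρ ^ m
          ≤ (m + 1) * (C * M) := by
        calc _ ≤ (∑ k ∈ Finset.range (m + 1), ‖odeCoeff a A B k * a (m - k)‖) * ρ ^ m := by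
              gcongr; exact norm_sum_le _ _
          _ = ∑ k ∈ Finset.range (m + 1), d k * (‖a (m - k)‖ * ρ ^ (m - k)) := by
              rw [Finset.sum_mul]
              refine Finset.sum_congr rfl fun k hk => ?_
              have : k ≤ m := by have := Finset.mem_range.1 hk; omega
              rw [← pow_mul_pow_sub ρ this, norm_mul]; simp only [hd]; ring
          _ ≤ ∑ k ∈ Finset.range (m + 1), C * M := by
              refine Finset.sum_le_sum fun k hk => ?_
              have : k < m + 2 := by have := Finset.mem_range.1 hk; omega
              exact mul_le_mul (ih k this) (hM _) (by positivity) hC0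
          _ = _ := by simp
      have h5 : d (m + 2) = (‖∑ k ∈ Finset.range (m + 1), odeCoeff a A B k * a (m - k)‖ * ρ ^ m)
          * ρ ^ 2 / ((m + 2) * (m + 1)) := by
        simp only [hd]; rw [odeCoeff_add_two, norm_div, h3]; ring
      rw [h5, div_le_iff₀ (by positivity)]
      calc _ ≤ ((m + 1) * (C * M)) * 1 :=
            mul_le_mul h4 (pow_le_one₀ h0.le h1.le) (by positivity) (by positivity)
        _ ≤ ((m + 1) * (C * (m + 2))) * 1 := by gcongr; linarith
        _ = _ := by ring

theorem exists_powerSeries_of_differentiableOn_ball {q : ℂ → ℂ}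
    (hq : DifferentiableOn ℂ q (Metric.ball 0 1)) :
    ∃ a : ℕ → ℂ, ConvergesOnDisc a ∧ ∀ w ∈ Metric.ball (0 : ℂ) 1, q w = ∑' n, a n * w ^ n := by
  have hs : ∀ w ∈ Metric.ball (0 : ℂ) 1,
      HasSum (fun n : ℕ => ((n.factorial : ℂ)⁻¹ * iteratedDeriv n q 0) * w ^ n) (q w) := by
    intro w hw
    refine (Complex.hasSum_taylorSeries_on_ball hq hw).congr_fun ?_
    intro n
    simp only [smul_eq_mul, sub_zero]; ring
  refine ⟨_, fun ρ h0 h1 => ?_, fun w hw => (hs w hw).tsum_eq.symm⟩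
  have hρ : (ρ : ℂ) ∈ Metric.ball (0 : ℂ) 1 := by simpa [abs_of_pos h0] using h1
  obtain ⟨C, hC⟩ := (hs _ hρ).summable.tendsto_atTop_zero.norm.bddAbove_range
  refine ⟨C, fun n => ?_⟩
  have := hC ⟨n, rfl⟩
  simpa only [norm_mul, norm_pow, Complex.norm_real, Real.norm_eq_abs, abs_of_pos h0] using this

theorem exists_solution_on_disc {q : ℂ → ℂ} (hq : DifferentiableOn ℂ q (Metric.ball 0 1))
    (A B : ℂ) : ∃ v v' : ℂ → ℂ, v 0 = A ∧ v' 0 = B ∧ ∀ w ∈ Metric.ball (0 : ℂ) 1,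
      HasDerivAt v (v' w) w ∧ HasDerivAt v' (q w * v w) w := by
  obtain ⟨a, ha, haq⟩ := exists_powerSeries_of_differentiableOn_ball hq
  have hc := convergesOnDisc_odeCoeff ha A B
  refine ⟨fun w => ∑' n, odeCoeff a A B n * w ^ n,
    fun w => ∑' n : ℕ, ((n + 1) * odeCoeff a A B (n + 1)) * w ^ n, ?_, ?_, fun w hw =>
    ⟨hc.hasDerivAt hw, ?_⟩⟩
  · refine (tsum_eq_single 0 (fun n hn => by simp [hn])).trans ?_
    simp [odeCoeff]
  · refine (tsum_eq_single 0 (fun n hn => by simp [hn])).trans ?_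
    simp [odeCoeff]
  · convert hc.derivative.hasDerivAt hw using 1
    rw [haq w hw, mul_comm, tsum_mul_tsum_eq_tsum_sum_range_of_summable_norm
      (hc.summable_norm hw) (ha.summable_norm hw)]
    refine tsum_congr fun n => ?_
    rw [odeCoeff_add_two]
    have h1 : (n : ℂ) + 1 ≠ 0 := by exact_mod_cast n.succ_ne_zero
    have h2 : (n : ℂ) + 2 ≠ 0 := by exact_mod_cast (n + 1).succ_ne_zero
    have h3 : ((n : ℂ) + 1) * (((n + 1 : ℕ) : ℂ) + 1) *
        ((∑ k ∈ Finset.range (n + 1), odeCoeff a A B k * a (n - k)) / ((n + 2) * (n + 1)))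
        = ∑ k ∈ Finset.range (n + 1), odeCoeff a A B k * a (n - k) := by
      push_cast; field_simp; ring
    rw [← mul_assoc, h3, Finset.sum_mul]
    refine Finset.sum_congr rfl fun k hk => ?_
    have : k ≤ n := by have := Finset.mem_range.1 hk; omega
    rw [← pow_mul_pow_sub w this]; ring

/-! ### Transport to the upper half-plane by the Cayley transform. -/

theorem cayley_inverse_im_pos {w : ℂ} (hw : w ∈ Metric.ball (0 : ℂ) 1) :
    0 < (Complex.I * (1 + w) / (1 - w)).im := by
  have h1 : ‖w‖ < 1 := mem_ball_zero_iff.1 hw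
  have h2 : Complex.normSq w < 1 := by
    rw [Complex.normSq_eq_norm_sq]; nlinarith [norm_nonneg w]
  have hne : 1 - w ≠ 0 := by
    intro h
    rw [← sub_eq_zero.1 h] at h1; simp at h1
  have h3 : 0 < Complex.normSq (1 - w) := Complex.normSq_pos.2 hne
  have : (Complex.I * (1 + w) / (1 - w)).im = (1 - Complex.normSq w) / Complex.normSq (1 - w) := by
    rw [Complex.div_im, ← sub_div]; congr 1
    simp [Complex.normSq_apply]; ring
  rw [this]; exact div_pos (by linarith) h3

theorem cayley_mem_ball {z : ℂ} (hz : 0 < z.im) :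
    (z - Complex.I) / (z + Complex.I) ∈ Metric.ball (0 : ℂ) 1 := by
  rw [mem_ball_zero_iff, norm_div]
  have hne : z + Complex.I ≠ 0 := by
    intro h; have := congrArg Complex.im h; simp at this; linarith
  rw [div_lt_one (norm_pos_iff.2 hne)]
  refine lt_of_pow_lt_pow_left₀ 2 (norm_nonneg _) ?_
  rw [← Complex.normSq_eq_norm_sq, ← Complex.normSq_eq_norm_sq]
  simp [Complex.normSq_apply]; nlinarith

/-- Solutions transform as densities of weight `-1 / 2`: with `w = (z - i) / (z + i)`, the factor `z
+ i` is a constant times `(dw/dz)^(-1/2)` and cancels the first-order term. A Möbius map has zero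
Schwarzian, so the potential on the disc is just `Q(z) (dz/dw)²`. -/
theorem exists_solution_on_upperHalfPlane {Q : ℂ → ℂ}
    (hQ : DifferentiableOn ℂ Q {z | 0 < z.im}) (A B : ℂ) :
    ∃ u u' : ℂ → ℂ, u Complex.I = A ∧ u' Complex.I = B ∧ ∀ z : ℂ, 0 < z.im →
      HasDerivAt u (u' z) z ∧ HasDerivAt u' (Q z * u z) z := by
  have hq : DifferentiableOn ℂ
      (fun w => -4 * Q (Complex.I * (1 + w) / (1 - w)) / (1 - w) ^ 4) (Metric.ball 0 1) := by
    have hne : ∀ w ∈ Metric.ball (0 : ℂ) 1, 1 - w ≠ 0 := by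
      intro w hw h
      have h1 : ‖w‖ < 1 := mem_ball_zero_iff.1 hw
      rw [← sub_eq_zero.1 h] at h1; simp at h1
    have h1 : DifferentiableOn ℂ (fun w : ℂ => Complex.I * (1 + w) / (1 - w))
        (Metric.ball 0 1) := DifferentiableOn.div (by fun_prop) (by fun_prop) hne
    exact ((hQ.comp h1 fun w hw => cayley_inverse_im_pos hw).const_mul _).div (by fun_prop)
      fun w hw => pow_ne_zero _ (hne w hw)
  -- At `z = i` the formulas below read `u = 2 i v(0)` and `u' = v(0) + v'(0)`.
  obtain ⟨v, v', h0, h0', hv⟩ :=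
    exists_solution_on_disc hq (A / (2 * Complex.I)) (B - A / (2 * Complex.I))
  have hI := Complex.I_ne_zero
  refine ⟨fun z => (z + Complex.I) * v ((z - Complex.I) / (z + Complex.I)),
    fun z => v ((z - Complex.I) / (z + Complex.I)) +
      2 * Complex.I * v' ((z - Complex.I) / (z + Complex.I)) / (z + Complex.I), ?_, ?_, ?_⟩
  · simp only [sub_self, zero_div, h0]; field_simp; ring
  · simp only [sub_self, zero_div, h0, h0']; field_simp; ring
  · intro z hz
    have hne : z + Complex.I ≠ 0 := by
      intro h; have := congrArg Complex.im h; simp at this; linarith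
    obtain ⟨hv1, hv2⟩ := hv _ (cayley_mem_ball hz)
    have hd : HasDerivAt (fun z => z + Complex.I) 1 z := (hasDerivAt_id z).add_const _
    have hw : HasDerivAt (fun z => (z - Complex.I) / (z + Complex.I))
        (2 * Complex.I / (z + Complex.I) ^ 2) z := by
      refine (((hasDerivAt_id z).sub_const Complex.I).div hd hne).congr_deriv ?_
      simp only [id]; ring
    have hz1 : Complex.I * (1 + (z - Complex.I) / (z + Complex.I)) /
        (1 - (z - Complex.I) / (z + Complex.I)) = z := by
      have : 1 - (z - Complex.I) / (z + Complex.I) = 2 * Complex.I / (z + Complex.I) := by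
        field_simp; ring
      rw [this]; field_simp; ring
    have hz2 : 1 - (z - Complex.I) / (z + Complex.I) = 2 * Complex.I / (z + Complex.I) := by
      field_simp; ring
    have hV := hv1.comp z hw
    have hV' := hv2.comp z hw
    rw [hz1, hz2] at hV'
    constructor
    · refine (hd.mul hV).congr_deriv ?_
      simp only [Function.comp]; field_simp
    · refine (hV.add ((hV'.const_mul (2 * Complex.I)).div hd hne)).congr_deriv ?_
      simp only [Function.comp]
      have h4 : Complex.I ^ 4 = 1 := Complex.I_pow_four
      rw [div_pow, mul_pow, h4]
      field_simp
      linear_combination (-4 * (z + Complex.I) ^ 3 * Q z *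
        v ((z - Complex.I) / (z + Complex.I))) * Complex.I_sq

/-! ### Bounded solutions of the Riccati equation. -/

open MeasureTheory Set in
/-- The bounded solution of `y' + y = h`. -/
def expAverage (h : ℝ → ℂ) (x : ℝ) : ℂ := (Real.exp (-x) : ℂ) * ∫ t in Iic x, (Real.exp t : ℂ) * h t

open MeasureTheory Set in
theorem integrableOn_exp_mul {h : ℝ → ℂ} (hc : Continuous h) {M : ℝ} (hM : ∀ t, ‖h t‖ ≤ M) (x : ℝ) :
    IntegrableOn (fun t => (Real.exp t : ℂ) * h t) (Iic x) := by
  refine Integrable.mono' ((integrableOn_exp_Iic x).mul_const M)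
    (Continuous.aestronglyMeasurable (by fun_prop)) (ae_of_all _ fun t => ?_)
  rw [norm_mul, Complex.norm_real, Real.norm_eq_abs, abs_of_pos (Real.exp_pos t)]
  gcongr; exact hM t

-- The kernel `e^(t - x)` on `t ≤ x` has total mass `1`.
open MeasureTheory Set in
theorem norm_expAverage_le {h : ℝ → ℂ} {M : ℝ} (hM : ∀ t, ‖h t‖ ≤ M) (x : ℝ) :
    ‖expAverage h x‖ ≤ M := by
  have h1 : ‖∫ t in Iic x, (Real.exp t : ℂ) * h t‖ ≤ ∫ t in Iic x, Real.exp t * M := by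
    refine norm_integral_le_of_norm_le ((integrableOn_exp_Iic x).mul_const M)
      (ae_of_all _ fun t => ?_)
    rw [norm_mul, Complex.norm_real, Real.norm_eq_abs, abs_of_pos (Real.exp_pos t)]
    gcongr; exact hM t
  rw [integral_mul_const, integral_exp_Iic] at h1
  rw [expAverage, norm_mul, Complex.norm_real, Real.norm_eq_abs, abs_of_pos (Real.exp_pos _)]
  calc _ ≤ Real.exp (-x) * (Real.exp x * M) := by gcongr
    _ = M := by rw [← mul_assoc, ← Real.exp_add]; simp

open MeasureTheory Set in
theorem expAverage_sub {h k : ℝ → ℂ} (hc : Continuous h) (kc : Continuous k) {M N : ℝ}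
    (hM : ∀ t, ‖h t‖ ≤ M) (kN : ∀ t, ‖k t‖ ≤ N) (x : ℝ) :
    expAverage h x - expAverage k x = expAverage (fun t => h t - k t) x := by
  simp only [expAverage, mul_sub]
  rw [integral_sub (integrableOn_exp_mul hc hM x) (integrableOn_exp_mul kc kN x), mul_sub]

open MeasureTheory Set in
theorem hasDerivAt_expAverage {h : ℝ → ℂ} (hc : Continuous h) {M : ℝ} (hM : ∀ t, ‖h t‖ ≤ M)
    (x : ℝ) : HasDerivAt (expAverage h) (h x - expAverage h x) x := by
  have hcont : Continuous fun t => (Real.exp t : ℂ) * h t := by fun_prop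
  have h1 : HasDerivAt (fun x => ∫ t in Iic x, (Real.exp t : ℂ) * h t) ((Real.exp x : ℂ) * h x) x := by
    have h2 := (hcont.integral_hasStrictDerivAt 0 x).hasDerivAt.const_add
      (∫ t in Iic (0 : ℝ), (Real.exp t : ℂ) * h t)
    refine h2.congr_of_eventuallyEq (Eventually.of_forall fun y => ?_)
    simp only []
    rw [← intervalIntegral.integral_Iic_sub_Iic (integrableOn_exp_mul hc hM 0)
      (integrableOn_exp_mul hc hM y)]
    ring
  have h3 : HasDerivAt (fun x : ℝ => (Real.exp (-x) : ℂ)) (-(Real.exp (-x) : ℂ)) x := by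
    have := ((hasDerivAt_neg x).exp).ofReal_comp
    simpa using this
  refine (h3.mul h1).congr_deriv ?_
  have h4 : (Real.exp (-x) : ℂ) * (Real.exp x : ℂ) = 1 := by
    rw [← Complex.ofReal_mul, ← Real.exp_add]; simp
  simp only [expAverage]
  linear_combination h x * h4

open scoped BoundedContinuousFunction in
/-- The Riccati equation `α' = -α - α² - ψ / 2` has a small bounded solution if `ψ` is small. -/
theorem exists_bounded_riccati {ψ : ℝ → ℂ} (hψ : Continuous ψ) {K : ℝ} (hK : ∀ x, ‖ψ x‖ ≤ K)
    (hK8 : K ≤ 1 / 8) :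
    ∃ α : ℝ → ℂ, (∀ x, ‖α x‖ ≤ K) ∧ ∀ x, HasDerivAt α (-α x - α x ^ 2 - ψ x / 2) x := by
  have hK0 : 0 ≤ K := (norm_nonneg _).trans (hK 0)
  have hb : ∀ (α : ℝ →ᵇ ℂ) (R : ℝ), ‖α‖ ≤ R → ∀ t, ‖α t ^ 2 + ψ t / 2‖ ≤ R ^ 2 + K / 2 := by
    intro α R hR t
    refine (norm_add_le _ _).trans ?_
    rw [norm_pow, norm_div, Complex.norm_ofNat]
    have := (α.norm_coe_le_norm t).trans hR
    have := hK t
    gcongr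
  have hc : ∀ α : ℝ →ᵇ ℂ, Continuous fun t => α t ^ 2 + ψ t / 2 := fun α => by
    have := α.continuous
    fun_prop
  -- A fixed point of `T` is a bounded solution of `α' + α = -(α² + ψ / 2)`.
  let T : (ℝ →ᵇ ℂ) → (ℝ →ᵇ ℂ) := fun α => BoundedContinuousFunction.ofNormedAddCommGroup
    (fun x => -expAverage (fun t => α t ^ 2 + ψ t / 2) x)
    (continuous_iff_continuousAt.2 fun x =>
      (hasDerivAt_expAverage (hc α) (hb α _ le_rfl) x).continuousAt.neg)
    (‖α‖ ^ 2 + K / 2) (fun x => by rw [norm_neg]; exact norm_expAverage_le (hb α _ le_rfl) x)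
  have hT : ∀ α x, T α x = -expAverage (fun t => α t ^ 2 + ψ t / 2) x := fun _ _ => rfl
  set s : Set (ℝ →ᵇ ℂ) := Metric.closedBall 0 K with hs
  have hmaps : Set.MapsTo T s s := by
    intro α hα
    rw [hs, mem_closedBall_zero_iff] at hα ⊢
    rw [BoundedContinuousFunction.norm_le hK0]
    intro x
    rw [hT, norm_neg]
    refine (norm_expAverage_le (hb α _ hα) x).trans ?_
    -- `K² + K / 2 ≤ K` because `K ≤ 1 / 2`.
    nlinarith
  have hcontr : ContractingWith (1 / 4) (hmaps.restrict T s s) := by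
    refine ⟨by rw [← NNReal.coe_lt_coe]; norm_num, LipschitzWith.of_dist_le_mul ?_⟩
    rintro ⟨α, hα⟩ ⟨β, hβ⟩
    rw [hs, mem_closedBall_zero_iff] at hα hβ
    simp only [Subtype.dist_eq, Set.MapsTo.val_restrict_apply]
    rw [BoundedContinuousFunction.dist_le (by positivity)]
    intro x
    rw [hT, hT, dist_neg_neg, dist_eq_norm,
      expAverage_sub (hc α) (hc β) (hb α _ le_rfl) (hb β _ le_rfl)]
    refine norm_expAverage_le (fun t => ?_) x
    have e : α t ^ 2 + ψ t / 2 - (β t ^ 2 + ψ t / 2) = (α t + β t) * (α t - β t) := by ring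
    rw [e, norm_mul]
    -- The contraction constant is `2 K ≤ 1 / 4`.
    have h1 : ‖α t + β t‖ ≤ 1 / 4 := by
      have h2 := (α.norm_coe_le_norm t).trans hα
      have h3 := (β.norm_coe_le_norm t).trans hβ
      linarith [norm_add_le (α t) (β t)]
    have h2 : ‖α t - β t‖ ≤ dist α β := by
      rw [← dist_eq_norm]; exact BoundedContinuousFunction.dist_coe_le_dist t
    have h3 : ((1 / 4 : NNReal) : ℝ) = 1 / 4 := by norm_num
    rw [h3]
    gcongr
  obtain ⟨α, hα, hfix, -⟩ := hcontr.exists_fixedPoint' Metric.isClosed_closedBall.isComplete hmaps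
    (Metric.mem_closedBall_self hK0 : (0 : ℝ →ᵇ ℂ) ∈ s) (edist_ne_top _ _)
  rw [hs, mem_closedBall_zero_iff] at hα
  refine ⟨α, fun x => (α.norm_coe_le_norm x).trans hα, fun x => ?_⟩
  have he : ∀ x, α x = -expAverage (fun t => α t ^ 2 + ψ t / 2) x := fun x => by
    rw [← hT, hfix.eq]
  have hd := (hasDerivAt_expAverage (hc α) (hb α _ le_rfl) x).neg
  have hd' : HasDerivAt α _ x := hd.congr_of_eventuallyEq (Eventually.of_forall he)
  refine hd'.congr_deriv ?_
  have := he x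
  linear_combination this

/-! ### Quotients of solutions as maps to the sphere. -/

/-- `u` solves `u'' = Q u` on the upper half-plane, with derivative `u'`. -/
def SolvesLinearODE (Q u u' : ℂ → ℂ) : Prop :=
  ∀ z : ℂ, 0 < z.im → HasDerivAt u (u' z) z ∧ HasDerivAt u' (Q z * u z) z

theorem eventually_im_pos {z : ℂ} (hz : 0 < z.im) : ∀ᶠ ζ : ℂ in 𝓝 z, 0 < ζ.im :=
  Complex.continuous_im.continuousAt.eventually (lt_mem_nhds hz)

theorem SolvesLinearODE.exists_wronskian {Q u u' v v' : ℂ → ℂ} (hu : SolvesLinearODE Q u u')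
    (hv : SolvesLinearODE Q v v') :
    ∃ W : ℂ, ∀ z : ℂ, 0 < z.im → u' z * v z - u z * v' z = W := by
  refine ⟨u' Complex.I * v Complex.I - u Complex.I * v' Complex.I, fun z hz => ?_⟩
  have hd : ∀ z : ℂ, 0 < z.im → HasDerivAt (fun z => u' z * v z - u z * v' z) 0 z := by
    intro z hz
    obtain ⟨h1, h2⟩ := hu z hz
    obtain ⟨h3, h4⟩ := hv z hz
    refine ((h2.mul h3).sub (h1.mul h4)).congr_deriv ?_
    ring
  have hopen : IsOpen {z : ℂ | 0 < z.im} := isOpen_lt continuous_const Complex.continuous_im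
  exact hopen.is_const_of_deriv_eq_zero (convex_halfSpace_im_gt 0).isPreconnected
    (fun z hz => (hd z hz).differentiableAt.differentiableWithinAt) (fun z hz => (hd z hz).deriv)
    hz (by simp)

theorem SolvesLinearODE.hasDerivAt_div {Q u u' v v' : ℂ → ℂ} (hu : SolvesLinearODE Q u u')
    (hv : SolvesLinearODE Q v v') {W : ℂ} (hW : ∀ z : ℂ, 0 < z.im → u' z * v z - u z * v' z = W)
    {z : ℂ} (hz : 0 < z.im) (hvz : v z ≠ 0) :
    HasDerivAt (fun ζ => u ζ / v ζ) (W / v z ^ 2) z := by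
  rw [← hW z hz]
  exact (hu z hz).1.div (hv z hz).1 hvz

theorem schwarzian_eq_of_hasDerivAt {g g₁ g₂ g₃ : ℂ → ℂ} {z : ℂ}
    (h₁ : ∀ᶠ ζ in 𝓝 z, HasDerivAt g (g₁ ζ) ζ) (h₂ : ∀ᶠ ζ in 𝓝 z, HasDerivAt g₁ (g₂ ζ) ζ)
    (h₃ : HasDerivAt g₂ (g₃ z) z) :
    schwarzian g z = g₃ z / g₁ z - 3 / 2 * (g₂ z / g₁ z) ^ 2 := by
  have e1 : deriv g =ᶠ[𝓝 z] g₁ := h₁.mono fun ζ h => h.deriv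
  have e2 : deriv (deriv g) =ᶠ[𝓝 z] g₂ := by
    filter_upwards [e1.eventuallyEq_nhds, h₂] with ζ h h'
    rw [h.deriv_eq, h'.deriv]
  have e3 : deriv (deriv (deriv g)) z = g₃ z := by rw [e2.deriv_eq, h₃.deriv]
  simp only [schwarzian, iteratedDeriv_succ, iteratedDeriv_zero, e3, e2.eq_of_nhds, e1.eq_of_nhds]

/-- The derivative `W / v²` of the quotient has logarithmic derivative `-2 v' / v`; the terms in
`(v' / v)²` cancel in the Schwarzian. -/
theorem SolvesLinearODE.schwarzian_div {Q u u' v v' : ℂ → ℂ} (hu : SolvesLinearODE Q u u')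
    (hv : SolvesLinearODE Q v v') {W : ℂ} (hW : ∀ z : ℂ, 0 < z.im → u' z * v z - u z * v' z = W)
    (hW0 : W ≠ 0) {z : ℂ} (hz : 0 < z.im) (hvz : v z ≠ 0) :
    schwarzian (fun ζ => u ζ / v ζ) z = -2 * Q z := by
  have hev : ∀ᶠ ζ in 𝓝 z, 0 < ζ.im ∧ v ζ ≠ 0 :=
    (eventually_im_pos hz).and ((hv z hz).1.continuousAt.eventually_ne hvz)
  have h2 : ∀ ζ : ℂ, 0 < ζ.im ∧ v ζ ≠ 0 →
      HasDerivAt (fun ζ => W / v ζ ^ 2) (-2 * W * v' ζ / v ζ ^ 3) ζ := by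
    rintro ζ ⟨h1, h2⟩
    refine (((hasDerivAt_const ζ W).div ((hv ζ h1).1.pow 2) (pow_ne_zero 2 h2))).congr_deriv ?_
    simp only [Pi.pow_apply]; field_simp; norm_num; ring
  have h3 : HasDerivAt (fun ζ => -2 * W * v' ζ / v ζ ^ 3)
      (-2 * W * (Q z * v z) / v z ^ 3 + 6 * W * v' z ^ 2 / v z ^ 4) z := by
    refine (((hv z hz).2.const_mul (-2 * W)).div ((hv z hz).1.pow 3)
      (pow_ne_zero 3 hvz)).congr_deriv ?_
    simp only [Pi.pow_apply]; field_simp; norm_num; ring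
  rw [schwarzian_eq_of_hasDerivAt (g₃ := fun z => -2 * W * (Q z * v z) / v z ^ 3 +
    6 * W * v' z ^ 2 / v z ^ 4)
    (hev.mono fun ζ h => hu.hasDerivAt_div hv hW h.1 h.2) (hev.mono h2) h3]
  field_simp; ring

/-- The map `[u : v]` to the Riemann sphere. -/
def projectiveMap (u v : ℂ → ℂ) (z : ℍ) : OnePoint ℂ :=
  if v z = 0 then ∞ else ((u z / v z : ℂ) : OnePoint ℂ)

theorem localRep_projectiveMap_of_ne_zero {u v : ℂ → ℂ} {z : ℍ} (hv : ContinuousAt v z)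
    (hvz : v z ≠ 0) : localRep (projectiveMap u v) z =ᶠ[𝓝 (z : ℂ)] fun ζ => u ζ / v ζ := by
  filter_upwards [eventually_im_pos z.im_pos, hv.eventually_ne hvz] with ζ h1 h2
  simp [localRep, projectiveMap, hvz, ofComplex_apply_of_im_pos h1, h2, sphereCoord, affineCoord]

/-- Where `v ζ = 0` both sides are `0`, whatever `u ζ` is, thanks to the value of `coordAtInfty` at
`∞`. -/
theorem localRep_projectiveMap_of_eq_zero {u v : ℂ → ℂ} {z : ℍ} (hvz : v z = 0) :
    localRep (projectiveMap u v) z =ᶠ[𝓝 (z : ℂ)] fun ζ => v ζ / u ζ := by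
  filter_upwards [eventually_im_pos z.im_pos] with ζ h1
  by_cases h2 : v ζ = 0
  · simp [localRep, projectiveMap, hvz, ofComplex_apply_of_im_pos h1, h2, sphereCoord, coordAtInfty]
  · simp [localRep, projectiveMap, hvz, ofComplex_apply_of_im_pos h1, h2, sphereCoord, coordAtInfty]

theorem continuous_projectiveMap {u v : ℂ → ℂ} (hu : ∀ z : ℍ, ContinuousAt u z)
    (hv : ∀ z : ℍ, ContinuousAt v z) (huv : ∀ z : ℍ, v z = 0 → u z ≠ 0) :
    Continuous (projectiveMap u v) := by
  refine continuous_iff_continuousAt.2 fun z => ?_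
  have hu' : ContinuousAt (fun z : ℍ => u z) z := (hu z).comp continuous_coe.continuousAt
  have hv' : ContinuousAt (fun z : ℍ => v z) z := (hv z).comp continuous_coe.continuousAt
  by_cases h : v z = 0
  · have e : projectiveMap u v z = ∞ := by simp [projectiveMap, h]
    rw [ContinuousAt, e, OnePoint.hasBasis_nhds_infty.tendsto_right_iff]
    rintro s ⟨-, hs⟩
    obtain ⟨R, hR⟩ := hs.isBounded.subset_closedBall (0 : ℂ)
    -- At a pole `|u| > R |v|` nearby, so the quotient leaves the ball of radius `R` containing the
    -- given compact set.
    have hlt : ∀ᶠ y : ℍ in 𝓝 z, R * ‖v y‖ < ‖u y‖ := by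
      refine Tendsto.eventually_lt ((hv'.norm).const_mul R) hu'.norm ?_
      simpa [h] using huv z h
    filter_upwards [hlt] with y hy
    by_cases h2 : v y = 0
    · simp [projectiveMap, h2]
    · left
      refine ⟨u y / v y, fun hmem => ?_, by simp [projectiveMap, h2]⟩
      have := hR hmem
      rw [mem_closedBall_zero_iff, norm_div, div_le_iff₀ (norm_pos_iff.2 h2)] at this
      linarith
  · have e : projectiveMap u v =ᶠ[𝓝 z] fun y => ((u y / v y : ℂ) : OnePoint ℂ) := by
      filter_upwards [hv'.eventually_ne h] with y hy
      simp [projectiveMap, hy]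
    refine ContinuousAt.congr ?_ e.symm
    exact OnePoint.continuous_coe.continuousAt.comp (hu'.div hv' h)

/-- The inverse function theorem in a single chart suffices: `localRep f z` factors through `f`, so
equal values of `f` give equal values of `localRep f z`. -/
theorem injOn_nhds_of_deriv_localRep_ne_zero {f : ℍ → OnePoint ℂ} {z : ℍ}
    (hd : AnalyticAt ℂ (localRep f z) z) (h0 : deriv (localRep f z) z ≠ 0) :
    ∃ U ∈ 𝓝 z, Set.InjOn f U := by
  have hs := hd.hasStrictDerivAt.hasStrictFDerivAt_equiv h0
  set e := hs.toOpenPartialHomeomorph (localRep f z)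
  refine ⟨(fun y : ℍ => (y : ℂ)) ⁻¹' e.source, ?_, ?_⟩
  · exact continuous_coe.continuousAt.preimage_mem_nhds
      (e.open_source.mem_nhds hs.mem_toOpenPartialHomeomorph_source)
  · intro x hx y hy hxy
    apply UpperHalfPlane.ext
    refine e.injOn hx hy ?_
    change localRep f z x = localRep f z y
    simp [localRep, hxy]

theorem SolvesLinearODE.analyticAt {Q u u' : ℂ → ℂ} (hu : SolvesLinearODE Q u u') (z : ℍ) :
    AnalyticAt ℂ u z :=
  Complex.analyticAt_iff_eventually_differentiableAt.2
    ((eventually_im_pos z.im_pos).mono fun ζ h => (hu ζ h).1.differentiableAt)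

theorem SolvesLinearODE.projectiveMap_spec {Q u u' v v' : ℂ → ℂ} (hu : SolvesLinearODE Q u u')
    (hv : SolvesLinearODE Q v v') {W : ℂ} (hW : ∀ z : ℂ, 0 < z.im → u' z * v z - u z * v' z = W)
    (hW0 : W ≠ 0) :
    LocallyUnivalent (projectiveMap u v) ∧
      ∀ z : ℍ, schwarzianOnH (projectiveMap u v) z = -2 * Q z := by
  have huv : ∀ z : ℍ, v z = 0 → u z ≠ 0 := by
    intro z h h'
    apply hW0
    rw [← hW z z.im_pos, h, h']; ring
  -- At poles the roles of `u` and `v` are exchanged, which changes the sign of the Wronskian.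
  have hW' : ∀ z : ℂ, 0 < z.im → v' z * u z - v z * u' z = -W := by
    intro z hz; rw [← hW z hz]; ring
  have key : ∀ z : ℍ, AnalyticAt ℂ (localRep (projectiveMap u v) z) z ∧
      deriv (localRep (projectiveMap u v) z) z ≠ 0 ∧
      schwarzian (localRep (projectiveMap u v) z) z = -2 * Q z := by
    intro z
    have hcongr : ∀ g : ℂ → ℂ, localRep (projectiveMap u v) z =ᶠ[𝓝 (z : ℂ)] g →
        schwarzian (localRep (projectiveMap u v) z) z = schwarzian g z := by
      intro g e
      simp only [schwarzian, e.iteratedDeriv_eq, e.deriv_eq]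
    by_cases h : v z = 0
    · have e := localRep_projectiveMap_of_eq_zero (u := u) h
      refine ⟨((hv.analyticAt z).div (hu.analyticAt z) (huv z h)).congr e.symm, ?_, ?_⟩
      · rw [e.deriv_eq, (hv.hasDerivAt_div hu hW' z.im_pos (huv z h)).deriv]
        exact div_ne_zero (neg_ne_zero.2 hW0) (pow_ne_zero 2 (huv z h))
      · rw [hcongr _ e, hv.schwarzian_div hu hW' (neg_ne_zero.2 hW0) z.im_pos (huv z h)]
    · have e := localRep_projectiveMap_of_ne_zero (u := u) (hv.analyticAt z).continuousAt h
      refine ⟨((hu.analyticAt z).div (hv.analyticAt z) h).congr e.symm, ?_, ?_⟩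
      · rw [e.deriv_eq, (hu.hasDerivAt_div hv hW z.im_pos h).deriv]
        exact div_ne_zero hW0 (pow_ne_zero 2 h)
      · rw [hcongr _ e, hu.schwarzian_div hv hW hW0 z.im_pos h]
  exact ⟨⟨⟨continuous_projectiveMap (fun z => (hu.analyticAt z).continuousAt)
    (fun z => (hv.analyticAt z).continuousAt) huv, fun z => (key z).1.differentiableAt⟩,
    fun z => injOn_nhds_of_deriv_localRep_ne_zero (key z).1 (key z).2.1⟩, fun z => (key z).2.2⟩

/-! ### Solutions along the imaginary axis. -/

theorem eq_exp_integral_of_hasDerivAt {y c : ℝ → ℂ} (hc : Continuous c)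
    (hy : ∀ x, HasDerivAt y (c x * y x) x) (x : ℝ) :
    y x = y 0 * Complex.exp (∫ t in (0 : ℝ)..x, c t) := by
  have hI : ∀ x, HasDerivAt (fun x => ∫ t in (0 : ℝ)..x, c t) (c x) x := fun x =>
    (hc.integral_hasStrictDerivAt 0 x).hasDerivAt
  have hd : ∀ x, HasDerivAt (fun x => y x * Complex.exp (-∫ t in (0 : ℝ)..x, c t)) 0 x := by
    intro x
    refine ((hy x).mul (hI x).neg.cexp).congr_deriv ?_
    ring
  have := is_const_of_deriv_eq_zero (fun x => (hd x).differentiableAt) (fun x => (hd x).deriv) x 0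
  simp only [intervalIntegral.integral_same, neg_zero, Complex.exp_zero, mul_one] at this
  rw [← this, mul_assoc, ← Complex.exp_add]; simp

/-- The arc length parametrization of the imaginary axis. -/
def axisCurve (x : ℝ) : ℂ := Complex.I * Real.exp x

theorem axisCurve_im_pos (x : ℝ) : 0 < (axisCurve x).im := by
  simp [axisCurve, -Complex.ofReal_exp, Real.exp_pos]

theorem hasDerivAt_axisCurve (x : ℝ) : HasDerivAt axisCurve (axisCurve x) x :=
  ((Real.hasDerivAt_exp x).ofReal_comp).const_mul Complex.I

theorem axisCurve_zero : axisCurve 0 = Complex.I := by simp [axisCurve]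

/-- A solution of `u'' = Q u` whose logarithmic derivative `z u' / u` at `i` agrees with that of a
global solution `a + 1 / 2` of the Riccati equation along the axis has no zeros there. -/
theorem SolvesLinearODE.eq_on_axis {Q u u' : ℂ → ℂ} (hu : SolvesLinearODE Q u u') {a : ℝ → ℂ}
    (ha : ∀ x, HasDerivAt a (1 / 4 + axisCurve x ^ 2 * Q (axisCurve x) - a x ^ 2) x)
    (h0 : u Complex.I = 1) (h1 : Complex.I * u' Complex.I = 1 / 2 + a 0) (x : ℝ) :
    axisCurve x * u' (axisCurve x) = (1 / 2 + a x) * u (axisCurve x) ∧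
      u (axisCurve x) = Complex.exp (∫ t in (0 : ℝ)..x, (1 / 2 + a t)) := by
  have hac : Continuous a := continuous_iff_continuousAt.2 fun x => (ha x).continuousAt
  have hz := hasDerivAt_axisCurve
  have hd1 : ∀ x, HasDerivAt (fun x => u (axisCurve x)) (axisCurve x * u' (axisCurve x)) x := by
    intro x
    refine ((hu _ (axisCurve_im_pos x)).1.comp x (hz x)).congr_deriv ?_
    ring
  have hd2 : ∀ x, HasDerivAt (fun x => u' (axisCurve x))
      (axisCurve x * (Q (axisCurve x) * u (axisCurve x))) x := by
    intro x
    refine ((hu _ (axisCurve_im_pos x)).2.comp x (hz x)).congr_deriv ?_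
    ring
  -- The defect `D = z u' - (1 / 2 + a) u` satisfies `D' = (1 / 2 - a) D` and `D(0) = 0`. No
  -- division by `u` occurs, so its nonvanishing is a consequence.
  have hD : ∀ x, axisCurve x * u' (axisCurve x) - (1 / 2 + a x) * u (axisCurve x) = 0 := by
    intro x
    rw [eq_exp_integral_of_hasDerivAt (c := fun x => 1 / 2 - a x)
      (y := fun x => axisCurve x * u' (axisCurve x) - (1 / 2 + a x) * u (axisCurve x))
      (by fun_prop) (fun x => ?_) x]
    · simp [axisCurve_zero, h0, h1]
    · refine (((hz x).mul (hd2 x)).sub (((ha x).const_add (1 / 2)).mul (hd1 x))).congr_deriv ?_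
      ring
  have hD' := fun x => sub_eq_zero.1 (hD x)
  refine ⟨hD' x, ?_⟩
  rw [eq_exp_integral_of_hasDerivAt (c := fun x => 1 / 2 + a x)
      (y := fun x => u (axisCurve x)) (by fun_prop) (fun x => ?_) x]
  · simp [axisCurve_zero, h0]
  · exact (hd1 x).congr_deriv (hD' x)

theorem re_integral_growth {g : ℝ → ℂ} (hg : Continuous g) (hre : ∀ x, 1 / 2 ≤ (g x).re) :
    Monotone fun x => (∫ t in (0 : ℝ)..x, g t).re - x / 2 := by
  have hd : ∀ x, HasDerivAt (fun x => (∫ t in (0 : ℝ)..x, g t).re - x / 2) ((g x).re - 1 / 2) x := by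
    intro x
    have h1 := (hg.integral_hasStrictDerivAt 0 x).hasDerivAt
    have h2 := (Complex.reCLM.hasFDerivAt.comp_hasDerivAt x h1)
    exact h2.sub ((hasDerivAt_id x).div_const 2)
  refine monotone_of_deriv_nonneg (fun x => (hd x).differentiableAt) fun x => ?_
  rw [(hd x).deriv]; linarith [hre x]

theorem tendsto_re_integral_atTop {g : ℝ → ℂ} (hg : Continuous g) (hre : ∀ x, 1 / 2 ≤ (g x).re) :
    Tendsto (fun x => (∫ t in (0 : ℝ)..x, g t).re) atTop atTop := by
  refine tendsto_atTop_mono' _ ?_ (tendsto_id.atTop_div_const (two_pos : (0 : ℝ) < 2))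
  filter_upwards [eventually_ge_atTop 0] with x hx
  have := re_integral_growth hg hre hx
  simp at this; simpa using this

theorem tendsto_re_integral_atBot {g : ℝ → ℂ} (hg : Continuous g) (hre : ∀ x, 1 / 2 ≤ (g x).re) :
    Tendsto (fun x => (∫ t in (0 : ℝ)..x, g t).re) atBot atBot := by
  refine tendsto_atBot_mono' _ ?_ (tendsto_id.atBot_div_const (two_pos : (0 : ℝ) < 2))
  filter_upwards [eventually_le_atBot 0] with x hx
  have := re_integral_growth hg hre hx
  simp at this; simpa using this

theorem coe_axisPoint {t : ℝ} (ht : 0 < t) : (axisPoint t : ℂ) = axisCurve (Real.log t) := by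
  have h : 0 < ((t : ℂ) * Complex.I).im := by simpa using ht
  rw [axisPoint, ofComplex_apply_of_im_pos h, axisCurve, Real.exp_log ht]
  exact mul_comm _ _

theorem exists_coe_eq_axisCurve {z : ℍ} (hz : z ∈ imagAxis) : ∃ x : ℝ, (z : ℂ) = axisCurve x := by
  refine ⟨Real.log z.im, ?_⟩
  rw [axisCurve, Real.exp_log z.im_pos]
  have h0 : z.re = 0 := hz
  apply Complex.ext <;> simp [h0]

theorem norm_eq_im_of_mem_imagAxis {z : ℍ} (hz : z ∈ imagAxis) : ‖(z : ℂ)‖ = z.im := by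
  have h0 : z.re = 0 := hz
  rw [← Complex.abs_im_eq_norm.2 h0]
  exact abs_of_pos z.im_pos

theorem norm_inv_sub_one_le {g : ℂ} {ε C : ℝ} (hε : ε ≤ 1 / 2) (hg : ‖g - 1‖ ≤ ε)
    (hC : 2 * ε ≤ C) : ‖g⁻¹ - 1‖ ≤ C := by
  have h1 : 1 / 2 ≤ ‖g‖ := by
    have := norm_sub_norm_le (1 : ℂ) g
    rw [norm_one, norm_sub_rev] at this; linarith
  have h0 : g ≠ 0 := norm_pos_iff.1 (by linarith)
  have e : g⁻¹ - 1 = -(g - 1) / g := by field_simp; ring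
  rw [e, norm_div, norm_neg, div_le_iff₀ (by linarith)]
  nlinarith [norm_nonneg (g - 1)]

/-- Two solutions of `u'' = Q u` whose quotient grows exponentially along the axis, when
`z² Q(z)` is bounded by `K / 2` there. -/
theorem exists_solutions_small_riccati {Q : ℂ → ℂ} (hQ : DifferentiableOn ℂ Q {z | 0 < z.im})
    {K : ℝ} (hK8 : K ≤ 1 / 8) (hK : ∀ x, ‖axisCurve x ^ 2 * Q (axisCurve x)‖ ≤ K / 2) :
    ∃ (u u' v v' : ℂ → ℂ) (a b : ℝ → ℂ), SolvesLinearODE Q u u' ∧ SolvesLinearODE Q v v' ∧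
      Continuous a ∧ Continuous b ∧ (∀ x, ‖a x - b x - 1‖ ≤ 2 * K) ∧
      (∀ x, axisCurve x * u' (axisCurve x) = (1 / 2 + a x) * u (axisCurve x) ∧
        u (axisCurve x) = Complex.exp (∫ t in (0 : ℝ)..x, (1 / 2 + a t))) ∧
      (∀ x, axisCurve x * v' (axisCurve x) = (1 / 2 + b x) * v (axisCurve x) ∧
        v (axisCurve x) = Complex.exp (∫ t in (0 : ℝ)..x, (1 / 2 + b t))) := by
  have hcurve : Continuous axisCurve := continuous_iff_continuousAt.2 fun x =>
    (hasDerivAt_axisCurve x).continuousAt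
  have hcont : Continuous fun x => -2 * (axisCurve x ^ 2 * Q (axisCurve x)) :=
    continuous_const.mul ((hcurve.pow 2).mul
      (hQ.continuousOn.comp_continuous hcurve axisCurve_im_pos))
  have hbd : ∀ x, ‖-2 * (axisCurve x ^ 2 * Q (axisCurve x))‖ ≤ K := by
    intro x
    rw [norm_mul, norm_neg, Complex.norm_ofNat]
    linarith [hK x]
  obtain ⟨α, hα, hα'⟩ := exists_bounded_riccati hcont hbd hK8
  -- Near `-1 / 2` the Riccati flow is repelling; reversing `x` turns it into the attracting case
  -- already solved.
  obtain ⟨β, hβ, hβ'⟩ := exists_bounded_riccati (hcont.comp continuous_neg)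
    (fun x => hbd (-x)) hK8
  set a : ℝ → ℂ := fun x => 1 / 2 + α x with ha
  set b : ℝ → ℂ := fun x => -(1 / 2 + β (-x)) with hb
  have ha' : ∀ x, HasDerivAt a (1 / 4 + axisCurve x ^ 2 * Q (axisCurve x) - a x ^ 2) x := by
    intro x
    refine ((hα' x).const_add (1 / 2)).congr_deriv ?_
    simp only [ha]; ring
  have hb' : ∀ x, HasDerivAt b (1 / 4 + axisCurve x ^ 2 * Q (axisCurve x) - b x ^ 2) x := by
    intro x
    have h1 := (hβ' (-x)).scomp x (hasDerivAt_neg x)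
    refine (h1.const_add (1 / 2)).neg.congr_deriv ?_
    simp only [hb, Function.comp, neg_neg]
    rw [Complex.real_smul]; push_cast; ring
  have hI := Complex.I_ne_zero
  obtain ⟨u, u', hu0, hu1, hu⟩ :=
    exists_solution_on_upperHalfPlane hQ 1 ((1 / 2 + a 0) / Complex.I)
  obtain ⟨v, v', hv0, hv1, hv⟩ :=
    exists_solution_on_upperHalfPlane hQ 1 ((1 / 2 + b 0) / Complex.I)
  refine ⟨u, u', v, v', a, b, hu, hv,
    continuous_iff_continuousAt.2 fun x => (ha' x).continuousAt,
    continuous_iff_continuousAt.2 fun x => (hb' x).continuousAt, fun x => ?_,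
    SolvesLinearODE.eq_on_axis hu ha' hu0 (by rw [hu1]; field_simp),
    SolvesLinearODE.eq_on_axis hv hb' hv0 (by rw [hv1]; field_simp)⟩
  have e : a x - b x - 1 = α x + β (-x) := by simp only [ha, hb]; ring
  rw [e]
  linarith [norm_add_le (α x) (β (-x)), hα x, hβ (-x)]

end HypSchwarzian
end


/-! ### The theorem. -/

open HypSchwarzian in
theorem theorem1p2 (φ : ℍ → ℂ) (K r : ℝ)
    (hφ : HypSchwarzian.IsHolomorphicQuadraticDifferential φ)
    (hr : 0 < r) (hr2 : r < 1 / 2) (hKr : K / r < 1 / 4)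
    (hK : ∀ z ∈ Metric.thickening r HypSchwarzian.imagAxis, HypSchwarzian.qdNorm φ z ≤ K) :
    ∃ f : ℍ → OnePoint ℂ,
      HypSchwarzian.LocallyUnivalent f ∧
      (∀ z : ℍ, HypSchwarzian.schwarzianOnH f z = φ z) ∧
      Tendsto (fun t : ℝ => f (HypSchwarzian.axisPoint t)) (𝓝[>] 0) (𝓝 ((0 : ℂ) : OnePoint ℂ)) ∧
      Tendsto (fun t : ℝ => f (HypSchwarzian.axisPoint t)) atTop (𝓝 (∞ : OnePoint ℂ)) ∧
      (∀ z ∈ HypSchwarzian.imagAxis, f z ≠ ((0 : ℂ) : OnePoint ℂ) ∧ f z ≠ (∞ : OnePoint ℂ)) ∧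
      (∀ z ∈ HypSchwarzian.imagAxis,
        HypSchwarzian.hypLength z
          (HypSchwarzian.pullback f HypSchwarzian.nSphere z - HypSchwarzian.nHalfPlane z)
            ≤ 9 * K / r) ∧
      (∀ z ∈ HypSchwarzian.imagAxis,
        HypSchwarzian.cylLength (f z)
          (HypSchwarzian.pushforward f HypSchwarzian.nHalfPlane z - HypSchwarzian.nSphere (f z))
            ≤ 9 * K / r) := by
  set Q : ℂ → ℂ := fun z => -(φ (ofComplex z)) / 2 with hQdef
  have hQ : DifferentiableOn ℂ Q {z | 0 < z.im} :=
    ((UpperHalfPlane.mdifferentiable_iff.1 hφ).neg).div_const 2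
  have haxis : ∀ x, ofComplex (axisCurve x) ∈ imagAxis := by
    intro x
    rw [ofComplex_apply_of_im_pos (axisCurve_im_pos x)]
    change (axisCurve x).re = 0
    simp [axisCurve, -Complex.ofReal_exp]
  have hKQ : ∀ x, ‖axisCurve x ^ 2 * Q (axisCurve x)‖ ≤ K / 2 := by
    intro x
    have h1 := hK _ (Metric.self_subset_thickening hr _ (haxis x))
    rw [qdNorm, ← norm_eq_im_of_mem_imagAxis (haxis x),
      ofComplex_apply_of_im_pos (axisCurve_im_pos x)] at h1
    rw [hQdef]
    simp only [norm_mul, norm_pow, norm_div, norm_neg, Complex.norm_ofNat,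
      ofComplex_apply_of_im_pos (axisCurve_im_pos x)]
    change ‖φ _‖ * ‖axisCurve x‖ ^ 2 ≤ K at h1
    linarith
  have hK0 : 0 ≤ K := by linarith [(norm_nonneg _).trans (hKQ 0)]
  -- `K < r / 4 < 1 / 8`.
  have hK8 : K ≤ 1 / 8 := by
    rw [div_lt_iff₀ hr] at hKr; linarith
  have hbound : 4 * K ≤ 9 * K / r := by
    rw [le_div_iff₀ hr]; nlinarith
  obtain ⟨u, u', v, v', a, b, hu, hv, hac, hbc, hab, hau, hbv⟩ :=
    exists_solutions_small_riccati hQ hK8 hKQ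
  obtain ⟨W, hW⟩ := hu.exists_wronskian hv
  have hu0 : ∀ x, u (axisCurve x) ≠ 0 := fun x => by
    rw [(hau x).2]; exact Complex.exp_ne_zero _
  have hv0 : ∀ x, v (axisCurve x) ≠ 0 := fun x => by
    rw [(hbv x).2]; exact Complex.exp_ne_zero _
  have hre : ∀ x, 1 / 2 ≤ (a x - b x).re := by
    intro x
    have h1 := (abs_le.1 ((Complex.abs_re_le_norm _).trans (hab x))).1
    simp only [Complex.sub_re, Complex.one_re] at h1 ⊢
    linarith
  have hab0 : ∀ x, a x - b x ≠ 0 := fun x h => by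
    have := hre x; rw [h] at this; norm_num at this
  -- As `f' = W / v²`, this says `z f' / f = a - b`.
  have hWab : ∀ x, axisCurve x * W = (a x - b x) * (u (axisCurve x) * v (axisCurve x)) := by
    intro x
    rw [← hW _ (axisCurve_im_pos x)]
    linear_combination v (axisCurve x) * (hau x).1 - u (axisCurve x) * (hbv x).1
  have hW0 : W ≠ 0 := by
    rintro rfl
    have := hWab 0
    rw [mul_zero] at this
    exact mul_ne_zero (hab0 0) (mul_ne_zero (hu0 0) (hv0 0)) this.symm
  obtain ⟨hf1, hf2⟩ := hu.projectiveMap_spec hv hW hW0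
  have hgc : Continuous fun x => a x - b x := hac.sub hbc
  have hquot : ∀ x, u (axisCurve x) / v (axisCurve x) =
      Complex.exp (∫ t in (0 : ℝ)..x, (a t - b t)) := by
    intro x
    rw [(hau x).2, (hbv x).2, ← Complex.exp_sub, ← intervalIntegral.integral_sub
      (Continuous.intervalIntegrable (by fun_prop) _ _)
      (Continuous.intervalIntegrable (by fun_prop) _ _)]
    congr 2; ext t; ring
  have hnorm : ∀ x, ‖u (axisCurve x) / v (axisCurve x)‖ =
      Real.exp (∫ t in (0 : ℝ)..x, (a t - b t)).re := fun x => by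
    rw [hquot, Complex.norm_exp]
  have hfaxis : ∀ t : ℝ, 0 < t → projectiveMap u v (axisPoint t) =
      ((u (axisCurve (Real.log t)) / v (axisCurve (Real.log t)) : ℂ) : OnePoint ℂ) := by
    intro t ht
    rw [projectiveMap, coe_axisPoint ht, if_neg (hv0 _)]
  -- Here `F = f(z)` and `g = z f'(z) / f(z)`; both length estimates depend on `g` alone.
  have hcomp : ∀ z ∈ imagAxis, ∃ g F : ℂ, F ≠ 0 ∧ ‖g - 1‖ ≤ 2 * K ∧ g ≠ 0 ∧
      projectiveMap u v z = (F : OnePoint ℂ) ∧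
      deriv (localRep (projectiveMap u v) z) z = g * F / z := by
    intro z hz
    obtain ⟨x, hx⟩ := exists_coe_eq_axisCurve hz
    have hvz : v z ≠ 0 := hx ▸ hv0 x
    refine ⟨a x - b x, u z / v z, div_ne_zero (hx ▸ hu0 x) hvz, hab x, hab0 x, ?_, ?_⟩
    · rw [projectiveMap, if_neg hvz]
    · rw [(localRep_projectiveMap_of_ne_zero (hv.analyticAt z).continuousAt hvz).deriv_eq,
        (hu.hasDerivAt_div hv hW z.im_pos hvz).deriv]
      have hz0 : (z : ℂ) ≠ 0 := z.ne_zero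
      have h1 := hWab x
      rw [← hx] at h1
      field_simp
      linear_combination h1
  refine ⟨projectiveMap u v, hf1, fun z => ?_, ?_, ?_, fun z hz => ?_, fun z hz => ?_,
    fun z hz => ?_⟩
  · rw [hf2, hQdef]; simp only [ofComplex_apply]; ring
  · have h1 : Tendsto (fun x => u (axisCurve x) / v (axisCurve x)) atBot (𝓝 0) := by
      rw [tendsto_zero_iff_norm_tendsto_zero]
      simp only [hnorm]
      exact Real.tendsto_exp_atBot.comp (tendsto_re_integral_atBot hgc hre)
    have h2 := (OnePoint.continuous_coe.tendsto (0 : ℂ)).comp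
      (h1.comp Real.tendsto_log_nhdsGT_zero)
    refine h2.congr' ?_
    filter_upwards [self_mem_nhdsWithin] with t ht
    exact (hfaxis t ht).symm
  · have h1 : Tendsto (fun x => u (axisCurve x) / v (axisCurve x)) atTop
        (coclosedCompact ℂ) := by
      rw [coclosedCompact_eq_cocompact, ← Metric.cobounded_eq_cocompact,
        ← tendsto_norm_atTop_iff_cobounded]
      simp only [hnorm]
      exact Real.tendsto_exp_atTop.comp (tendsto_re_integral_atTop hgc hre)
    have h2 := OnePoint.tendsto_coe_infty.comp (h1.comp Real.tendsto_log_atTop)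
    refine h2.congr' ?_
    filter_upwards [eventually_gt_atTop 0] with t ht
    exact (hfaxis t ht).symm
  · obtain ⟨g, F, hF, -, -, he, -⟩ := hcomp z hz
    rw [he]
    exact ⟨fun h => hF (OnePoint.coe_injective h), OnePoint.coe_ne_infty F⟩
  · obtain ⟨g, F, hF, hg, hg0, he, hd⟩ := hcomp z hz
    have hz0 : (z : ℂ) ≠ 0 := z.ne_zero
    rw [hypLength, pullback, hd, he, ← norm_eq_im_of_mem_imagAxis hz, ← norm_div]
    have e : (nSphere (F : OnePoint ℂ) / (g * F / z) - nHalfPlane z) / z = g⁻¹ - 1 := by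
      simp only [nSphere, nHalfPlane, OnePoint.elim_some, id]
      field_simp
    rw [e]
    exact norm_inv_sub_one_le (by linarith) hg (by linarith)
  · obtain ⟨g, F, hF, hg, hg0, he, hd⟩ := hcomp z hz
    have hz0 : (z : ℂ) ≠ 0 := z.ne_zero
    rw [cylLength, pushforward, hd, he, ← norm_div]
    have e : (g * F / z * nHalfPlane z - nSphere (F : OnePoint ℂ)) /
        affineCoord (F : OnePoint ℂ) = g - 1 := by
      simp only [nSphere, nHalfPlane, affineCoord, OnePoint.elim_some, id]
      field_simp
    rw [e]
    linarith
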